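/- Let $\mathcal A\subseteq\mathbb R^2$ be a finite set whose convex hull has dimension $2$, and let $\varepsilon\in\{\pm1\}^{\mathcal A}$. Put $\mathcal A_{\pm}=\{\alpha\in\mathcal A : \varepsilon_\alpha=\pm1\}$ and $\mathbb R^{\mathcal A}_\varepsilon=\{c\in\mathbb R^{\mathcal A} : \operatorname{sign}(c_\alpha)=\varepsilon_\alpha \text{ for all }\alpha\}$. For $c\in\mathbb R^{\mathcal A}_\varepsilon$ let $f_c(x)=\sum_{\alpha\in\mathcal A}c_\alpha e^{\alpha\cdot x}$, $x\in\mathbb R^2$, and let $\operatorname{Sing}(f_c)$ be the set of $x\in\mathbb R^2$ with $f_c(x)=\partial_1 f_c(x)=\partial_2 f_c(x)=0$. For $\{P,Q\}=\{\mathcal A_+,\mathcal A_-\}$, a pair of strict enclosing lines of $P$ is given by $v\in\mathbb R^2\setminus\{0\}$ and reals $a\ge b$ such that $b\le v\cdot p\le a$ for all $p\in P$; no $q\in Q$ satisfies $b<v\cdot q<a$; there is $q\in Q$ with $v\cdot q>a$; and there is $q\in Q$ with $v\cdot q<b$. Assume that both $\mathcal A_+$ and $\mathcal A_-$ have a pair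 of strict enclosing lines. Then: (i) For every $c\in\mathbb R^{\mathcal A}_\varepsilon$ and every $x\in\operatorname{Sing}(f_c)$, the Hessian matrix of $f_c$ at $x$ has a positive and a negative eigenvalue. (ii) Suppose $\#\mathcal A=5$. Let $\hat A$ be the $3\times5$ matrix with columns $\binom{1}{\alpha}$, $\alpha\in\mathcal A$, and let $B\in\mathbb R^{5\times2}$ be any matrix whose columns form a basis of $\ker\hat A$. Let $$\Gamma_\varepsilon(A,B)=\bigl\{B^\top\bigl(\log|c_\alpha|\bigr)_{\alpha\in\mathcal A} : c\in\mathbb R^{\mathcal A}_\varepsilon,\ \operatorname{Sing}(f_c)\neq\emptyset\bigr\}\subseteq\mathbb R^2 .$$ Then $\mathbb R^2\setminus\Gamma_\varepsilon(A,B)$ has at most two connected components. -/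

import Mathlib

noncomputable section

namespace SignedDisc

/-- `ℝⁿ` with its Euclidean scalar product. -/
abbrev E (n : ℕ) : Type := EuclideanSpace ℝ (Fin n)

/-- A signed support in `ℝⁿ`: a finite set of exponent vectors with a sign `±1` for each of them. -/
structure SignedSupport (n : ℕ) where
  supp : Finset (E n)
  sgn : supp → ℤˣ

namespace SignedSupport

variable {n : ℕ} (S : SignedSupport n)

/-- The positive exponent vectors. -/
def pos : Set (E n) := {α | ∃ h : α ∈ S.supp, S.sgn ⟨α, h⟩ = 1}

/-- The negative exponent vectors. -/
def neg : Set (E n) := {α | ∃ h : α ∈ S.supp, S.sgn ⟨α, h⟩ = -1}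

/-- The convex hull of the support has dimension `n`. -/
def FullDimensional : Prop :=
  Module.finrank ℝ (affineSpan ℝ (convexHull ℝ (S.supp : Set (E n)))).direction = n

/-- The open orthant of all coefficient vectors whose signs are the prescribed ones. -/
def orthant : Set (S.supp → ℝ) := {c | ∀ i, Real.sign (c i) = ((S.sgn i : ℤ) : ℝ)}

/-- The exponential sum `f_c(x) = ∑ c_α exp(α · x)`. -/
def expSum (c : S.supp → ℝ) (x : E n) : ℝ :=
  ∑ i : S.supp, c i * Real.exp (inner ℝ (i : E n) x)

end SignedSupport

/-- The partial derivative `∂f/∂x_j` as a function on `ℝⁿ`. -/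
def partialDeriv {n : ℕ} (j : Fin n) (f : E n → ℝ) (x : E n) : ℝ :=
  fderiv ℝ f x (EuclideanSpace.single j 1)

/-- The singular zeros of `f`. -/
def Sing {n : ℕ} (f : E n → ℝ) : Set (E n) :=
  {x | f x = 0 ∧ ∀ j, partialDeriv j f x = 0}

/-- The Hessian matrix of `f` at `x`. -/
def hess {n : ℕ} (f : E n → ℝ) (x : E n) : Matrix (Fin n) (Fin n) ℝ :=
  Matrix.of fun i j => partialDeriv i (partialDeriv j f) x

/-- The half-space `v · μ ≥ a`. -/
def halfSpaceGE {n : ℕ} (v : E n) (a : ℝ) : Set (E n) := {μ | a ≤ inner ℝ v μ}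

/-- The half-space `v · μ ≤ a`. -/
def halfSpaceLE {n : ℕ} (v : E n) (a : ℝ) : Set (E n) := {μ | inner ℝ v μ ≤ a}

/-- The parallel hyperplanes `v · μ = a` and `v · μ = b`, `a ≥ b`, enclose `P`, with `Q` outside
the open strip between them. -/
structure IsEnclosing {n : ℕ} (P Q : Set (E n)) (v : E n) (a b : ℝ) : Prop where
  normal_ne_zero : v ≠ 0
  le : b ≤ a
  inside : P ⊆ halfSpaceLE v a ∩ halfSpaceGE v b
  outside : Q ⊆ (interior (halfSpaceLE v a) ∩ interior (halfSpaceGE v b))ᶜ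

/-- Strict enclosing hyperplanes of `P`: moreover `Q` has points strictly beyond both of them. -/
structure IsStrictEnclosing {n : ℕ} (P Q : Set (E n)) (v : E n) (a b : ℝ) : Prop
    extends IsEnclosing P Q v a b where
  beyond_upper : (interior (halfSpaceGE v a) ∩ Q).Nonempty
  beyond_lower : (interior (halfSpaceLE v b) ∩ Q).Nonempty

namespace SignedSupport

variable {n : ℕ} (S : SignedSupport n)

/-- The matrix with columns `(1, α)`, for `α` in the support. -/
def hatA : Matrix (Fin (n + 1)) S.supp ℝ :=
  Matrix.of fun r i => (Fin.cons 1 (fun j => (i : E n) j) : Fin (n + 1) → ℝ) r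

/-- `B` is a Gale dual matrix: its columns form a basis of the kernel of `hatA`. -/
def IsGaleDual {k : ℕ} (B : Matrix S.supp (Fin k) ℝ) : Prop :=
  LinearIndependent ℝ B.col ∧
    Submodule.span ℝ (Set.range B.col) = LinearMap.ker S.hatA.mulVecLin

/-- The signed discriminant: coefficients with the prescribed signs for which the exponential sum
has a singular zero. -/
def disc : Set (S.supp → ℝ) := {c | c ∈ S.orthant ∧ (Sing (S.expSum c)).Nonempty}

/-- The signed reduced discriminant `Bᵀ Log |∇|` in `ℝᵏ`. -/
def reducedDisc {k : ℕ} (B : Matrix S.supp (Fin k) ℝ) : Set (Fin k → ℝ) :=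
  (fun c : S.supp → ℝ => Matrix.mulVec B.transpose (fun i => Real.log |c i|)) '' S.disc

end SignedSupport

end SignedDisc

end

/-! At a singular point `x`, the weights `w_α = c_α exp(α · x)` keep the signs of `c` and form an
affine relation: `∑ w_α = 0` and `∑ w_α α = 0`. The Hessian is their second moment matrix. For a
strip `b ≤ v · μ ≤ a` around the positive points, the vanishing lower moments give `vᵀHv = ∑ w_α (v
· α - a)(v · α - b)`. No term is positive and one is negative. The strip around the negative points,
applied to `-w`, gives a direction where the form is positive. Hence `det H < 0`
(`det_secondMoment_neg`), which is (i).

For (ii), the reduced discriminant is the image of `l ↦ Bᵀ log|Bl|` over the cone of `l` with `Bl`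
in the orthant (`mem_reducedDisc_iff`). The columns of `B` sum to zero, so scaling `l` has no effect
and a line `C + t D` of relations suffices, with `t` in an interval. In rotated coordinates the
curve is `(∑ D log|C + tD|, ∑ C log|C + tD|)`. The first coordinate has derivative `∑ D² / (C +
tD)`, and a zero of it would give a kernel vector of a second moment matrix (`sum_sq_div_ne_zero`).
By Rolle that coordinate is injective, so the curve is a graph over an interval, and every
complementary point can be joined to the region above or the region below it. -/

namespace SignedDisc

open Set Topology

/-! ### Components of the complement of a plane curve that projects injectively to an axis -/

/-- A space covered by preconnected sets, each of which contains one of two given points, has at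
most two connected components. -/
theorem card_connectedComponents_le_two {V : Type*} [TopologicalSpace V] {Z : Set V} {p q : V}
    (hp : p ∈ Z) (hq : q ∈ Z)
    (h : ∀ z ∈ Z, ∃ T ⊆ Z, IsPreconnected T ∧ z ∈ T ∧ (p ∈ T ∨ q ∈ T)) :
    ENat.card (ConnectedComponents Z) ≤ 2 := by
  have key : ∀ (T : Set V), T ⊆ Z → IsPreconnected T → ∀ x y : Z, x.1 ∈ T → y.1 ∈ T →
      ConnectedComponents.mk x = ConnectedComponents.mk y := by
    intro T hTZ hT x y hx hy
    have hpre : IsPreconnected ((↑) ⁻¹' T : Set Z) := by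
      rw [← IsInducing.subtypeVal.isPreconnected_image, Subtype.image_preimage_coe,
        inter_eq_right.2 hTZ]
      exact hT
    exact ConnectedComponents.coe_eq_coe'.2 (hpre.subset_connectedComponent hy hx)
  let f : Bool → ConnectedComponents Z := fun b =>
    if b then ConnectedComponents.mk ⟨p, hp⟩ else ConnectedComponents.mk ⟨q, hq⟩
  have hf : Function.Surjective f := by
    intro c
    obtain ⟨z, rfl⟩ := ConnectedComponents.surjective_coe c
    obtain ⟨T, hTZ, hT, hz, h1 | h1⟩ := h z z.2
    · exact ⟨true, key T hTZ hT ⟨p, hp⟩ z h1 hz⟩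
    · exact ⟨false, key T hTZ hT ⟨q, hq⟩ z h1 hz⟩
  calc ENat.card (ConnectedComponents Z) ≤ ENat.card Bool :=
        ENat.card_le_card_of_injective (Function.injective_surjInv hf)
    _ = 2 := by simp

/-- The plane curve with coordinate functions `X` and `Y`, parametrized by `I`. -/
def planeCurve (I : Set ℝ) (X Y : ℝ → ℝ) : Set (ℝ × ℝ) := {z | ∃ t ∈ I, z = (X t, Y t)}

/-- The points vertically above the plane curve. -/
def aboveCurve (I : Set ℝ) (X Y : ℝ → ℝ) : Set (ℝ × ℝ) := {z | ∃ t ∈ I, z.1 = X t ∧ Y t < z.2}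

/-- The points vertically below the plane curve. -/
def belowCurve (I : Set ℝ) (X Y : ℝ → ℝ) : Set (ℝ × ℝ) := {z | ∃ t ∈ I, z.1 = X t ∧ z.2 < Y t}

section planeCurve

variable {I : Set ℝ} {X Y : ℝ → ℝ}

theorem isPreconnected_aboveCurve (hI : IsPreconnected I) (hX : ContinuousOn X I)
    (hY : ContinuousOn Y I) : IsPreconnected (aboveCurve I X Y) := by
  have hc : ContinuousOn (fun z : ℝ × ℝ => (X z.1, Y z.1 + z.2)) (I ×ˢ Ioi 0) := by
    have h1 : MapsTo (Prod.fst : ℝ × ℝ → ℝ) (I ×ˢ Ioi 0) I := fun z hz => hz.1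
    exact (hX.comp continuousOn_fst h1).prodMk ((hY.comp continuousOn_fst h1).add continuousOn_snd)
  convert (hI.prod isPreconnected_Ioi).image _ hc using 1
  ext ⟨x, y⟩
  constructor
  · rintro ⟨t, ht, hx, hy⟩
    exact ⟨(t, y - Y t), ⟨ht, sub_pos.2 hy⟩, by simp [← hx]⟩
  · rintro ⟨⟨t, s⟩, ⟨ht, hs⟩, he⟩
    simp only [Prod.mk.injEq] at he
    exact ⟨t, ht, he.1.symm, by have : 0 < s := hs; simp only; linarith [he.2]⟩

theorem isPreconnected_belowCurve (hI : IsPreconnected I) (hX : ContinuousOn X I)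
    (hY : ContinuousOn Y I) : IsPreconnected (belowCurve I X Y) := by
  have h := (isPreconnected_aboveCurve hI hX hY.neg).image (fun z : ℝ × ℝ => (z.1, -z.2))
    (by fun_prop)
  convert h using 1
  ext ⟨x, y⟩
  constructor
  · rintro ⟨t, ht, hx, hy⟩
    exact ⟨(x, -y), ⟨t, ht, hx, neg_lt_neg hy⟩, by simp⟩
  · rintro ⟨⟨x', y'⟩, ⟨t, ht, hx, hy⟩, he⟩
    simp only [Prod.mk.injEq] at he
    exact ⟨t, ht, by simpa [← he.1] using hx, by simp only [Pi.neg_apply] at hy ⊢; linarith [he.2]⟩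

theorem aboveCurve_subset_compl (hinj : InjOn X I) :
    aboveCurve I X Y ⊆ (planeCurve I X Y)ᶜ := by
  rintro z ⟨t, ht, hx, hy⟩ ⟨s, hs, rfl⟩
  obtain rfl := hinj hs ht hx
  exact lt_irrefl _ hy

theorem belowCurve_subset_compl (hinj : InjOn X I) :
    belowCurve I X Y ⊆ (planeCurve I X Y)ᶜ := by
  rintro z ⟨t, ht, hx, hy⟩ ⟨s, hs, rfl⟩
  obtain rfl := hinj hs ht hx
  exact lt_irrefl _ hy

/-- Needed when the supremum of `X` on `I` is not attained: points over `X '' I` at a fixed height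
may lie on the curve, but they are still limits of points off it. -/
theorem mem_closure_above_union_below {t : ℝ} (ht : t ∈ I) (y : ℝ) :
    (X t, y) ∈ closure (aboveCurve I X Y ∪ belowCurve I X Y) := by
  rcases lt_trichotomy y (Y t) with h | h | h
  · exact subset_closure (Or.inr ⟨t, ht, rfl, h⟩)
  · subst h
    have : (X t, Y t) ∈ closure ((fun s => (X t, s)) '' Ioi (Y t)) :=
      image_closure_subset_closure_image (by fun_prop) ⟨Y t, by simp, rfl⟩
    refine closure_mono ?_ this
    rintro _ ⟨s, hs, rfl⟩
    exact Or.inl ⟨t, ht, rfl, hs⟩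
  · exact subset_closure (Or.inl ⟨t, ht, rfl, h⟩)

/-- Let `p` be the supremum of `X` on `I`. If it is attained at `t`, the open half-plane beyond `p`
has `(X t, Y t + 1)` in its closure and so joins the region above. If not, the closed half-plane
from `p` on avoids the curve, and `(p, 0)` is a limit of points above or below; which of the two
depends on the curve. -/
theorem exists_preconnected_of_right (hI : IsPreconnected I) (hne : I.Nonempty)
    (hX : ContinuousOn X I) (hY : ContinuousOn Y I) (hinj : InjOn X I) {z : ℝ × ℝ}
    (hz : ∀ t ∈ I, X t < z.1) :
    ∃ T ⊆ (planeCurve I X Y)ᶜ, IsPreconnected T ∧ z ∈ T ∧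
      (aboveCurve I X Y ⊆ T ∨ belowCurve I X Y ⊆ T) := by
  have hJne : (X '' I).Nonempty := hne.image X
  have hub : z.1 ∈ upperBounds (X '' I) := by
    rintro _ ⟨t, ht, rfl⟩
    exact (hz t ht).le
  have hbdd : BddAbove (X '' I) := ⟨z.1, hub⟩
  obtain ⟨p, hp⟩ : ∃ p, IsLUB (X '' I) p := ⟨_, isLUB_csSup hJne hbdd⟩
  by_cases hpJ : p ∈ X '' I
  · obtain ⟨t, ht, rfl⟩ := hpJ
    have hconv : IsPreconnected (Ioi (X t) ×ˢ (univ : Set ℝ)) :=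
      isPreconnected_Ioi.prod isPreconnected_univ
    have hcl : (X t, Y t + 1) ∈ closure (Ioi (X t) ×ˢ (univ : Set ℝ)) := by
      rw [closure_prod_eq]; simp
    have h1 : IsPreconnected (insert (X t, Y t + 1) (Ioi (X t) ×ˢ (univ : Set ℝ))) :=
      hconv.subset_closure (subset_insert _ _) (insert_subset hcl subset_closure)
    have hU : (X t, Y t + 1) ∈ aboveCurve I X Y := ⟨t, ht, rfl, by simp⟩
    refine ⟨insert (X t, Y t + 1) (Ioi (X t) ×ˢ (univ : Set ℝ)) ∪ aboveCurve I X Y, ?_,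
      h1.union _ (mem_insert _ _) hU (isPreconnected_aboveCurve hI hX hY),
      Or.inl (Or.inr ⟨hz t ht, mem_univ _⟩), Or.inl subset_union_right⟩
    refine union_subset (insert_subset (aboveCurve_subset_compl hinj hU) ?_)
      (aboveCurve_subset_compl hinj)
    rintro _ ⟨hw, -⟩ ⟨s, hs, rfl⟩
    exact absurd (hp.1 ⟨s, hs, rfl⟩) (not_le.2 hw)
  · have hR : IsPreconnected (Ici p ×ˢ (univ : Set ℝ)) :=
      isPreconnected_Ici.prod isPreconnected_univ
    have hRsub : Ici p ×ˢ (univ : Set ℝ) ⊆ (planeCurve I X Y)ᶜ := by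
      rintro _ ⟨hw, -⟩ ⟨s, hs, rfl⟩
      exact hpJ ⟨s, hs, le_antisymm (hp.1 ⟨s, hs, rfl⟩) hw⟩
    have hzR : z ∈ Ici p ×ˢ (univ : Set ℝ) := ⟨hp.2 hub, mem_univ _⟩
    have hpR : (p, (0 : ℝ)) ∈ Ici p ×ˢ (univ : Set ℝ) := ⟨le_refl p, mem_univ _⟩
    have hcl : (p, (0 : ℝ)) ∈ closure (aboveCurve I X Y ∪ belowCurve I X Y) := by
      have h1 : (p, (0 : ℝ)) ∈ closure ((fun s => (s, (0 : ℝ))) '' (X '' I)) :=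
        image_closure_subset_closure_image (by fun_prop) ⟨p, hp.mem_closure hJne, rfl⟩
      refine closure_minimal ?_ isClosed_closure h1
      rintro _ ⟨_, ⟨t, ht, rfl⟩, rfl⟩
      exact mem_closure_above_union_below ht 0
    have join : ∀ W : Set (ℝ × ℝ), IsPreconnected W → W ⊆ (planeCurve I X Y)ᶜ →
        (p, (0 : ℝ)) ∈ closure W →
        ∃ T ⊆ (planeCurve I X Y)ᶜ, IsPreconnected T ∧ z ∈ T ∧ W ⊆ T := by
      intro W hW hWsub hWcl
      have h1 : IsPreconnected (insert (p, (0 : ℝ)) W) :=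
        hW.subset_closure (subset_insert _ _) (insert_subset hWcl subset_closure)
      exact ⟨Ici p ×ˢ (univ : Set ℝ) ∪ insert (p, (0 : ℝ)) W,
        union_subset hRsub (insert_subset (hRsub hpR) hWsub),
        hR.union _ hpR (mem_insert _ _) h1, Or.inl hzR,
        (subset_insert _ _).trans subset_union_right⟩
    rw [closure_union] at hcl
    rcases hcl with hcl | hcl
    · obtain ⟨T, h1, h2, h3, h4⟩ := join _ (isPreconnected_aboveCurve hI hX hY)
        (aboveCurve_subset_compl hinj) hcl
      exact ⟨T, h1, h2, h3, Or.inl h4⟩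
    · obtain ⟨T, h1, h2, h3, h4⟩ := join _ (isPreconnected_belowCurve hI hX hY)
        (belowCurve_subset_compl hinj) hcl
      exact ⟨T, h1, h2, h3, Or.inr h4⟩

theorem exists_preconnected_of_left (hI : IsPreconnected I) (hne : I.Nonempty)
    (hX : ContinuousOn X I) (hY : ContinuousOn Y I) (hinj : InjOn X I) {z : ℝ × ℝ}
    (hz : ∀ t ∈ I, z.1 < X t) :
    ∃ T ⊆ (planeCurve I X Y)ᶜ, IsPreconnected T ∧ z ∈ T ∧
      (aboveCurve I X Y ⊆ T ∨ belowCurve I X Y ⊆ T) := by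
  -- Reflection in the vertical axis exchanges left and right and preserves above and below.
  obtain ⟨T, h1, h2, h3, h4⟩ := exists_preconnected_of_right (X := -X) (z := (-z.1, z.2)) hI hne
    hX.neg hY (fun s hs t ht h => hinj hs ht (neg_injective h)) (fun t ht => neg_lt_neg (hz t ht))
  have hmem : ∀ w : ℝ × ℝ, w ∈ (fun z : ℝ × ℝ => (-z.1, z.2)) '' T ↔ (-w.1, w.2) ∈ T := by
    intro w
    constructor
    · rintro ⟨v, hv, rfl⟩
      simpa using hv
    · intro hw
      exact ⟨_, hw, by simp⟩
  refine ⟨(fun z : ℝ × ℝ => (-z.1, z.2)) '' T, ?_, h2.image _ (by fun_prop), (hmem z).2 h3, ?_⟩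
  · intro w hw
    rw [hmem] at hw
    rintro ⟨t, ht, rfl⟩
    exact h1 hw ⟨t, ht, rfl⟩
  · refine h4.imp ?_ ?_
    · rintro h w ⟨t, ht, hx, hy⟩
      exact (hmem w).2 (h ⟨t, ht, by simp [hx], hy⟩)
    · rintro h w ⟨t, ht, hx, hy⟩
      exact (hmem w).2 (h ⟨t, ht, by simp [hx], hy⟩)

/-- If a curve in a topological plane has continuous coordinates over an interval, the first of
them injective, then its complement has at most two connected components. -/
theorem card_components_compl_planeCurve_le_two {V : Type*} [TopologicalSpace V]
    (e : V ≃ₜ ℝ × ℝ) (hI : IsPreconnected I)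
    (hX : ContinuousOn X I) (hY : ContinuousOn Y I) (hinj : InjOn X I) :
    ENat.card (ConnectedComponents ↥((e ⁻¹' planeCurve I X Y)ᶜ)) ≤ 2 := by
  have red : ∀ p q : ℝ × ℝ, p ∈ (planeCurve I X Y)ᶜ → q ∈ (planeCurve I X Y)ᶜ →
      (∀ z ∈ (planeCurve I X Y)ᶜ, ∃ T ⊆ (planeCurve I X Y)ᶜ, IsPreconnected T ∧ z ∈ T ∧
        (p ∈ T ∨ q ∈ T)) →
      ENat.card (ConnectedComponents ↥((e ⁻¹' planeCurve I X Y)ᶜ)) ≤ 2 := by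
    intro p q hp hq h
    refine card_connectedComponents_le_two (p := e.symm p) (q := e.symm q) (by simpa using hp)
      (by simpa using hq) fun z hz => ?_
    obtain ⟨T, h1, h2, h3, h4⟩ := h (e z) hz
    refine ⟨e ⁻¹' T, fun w hw => h1 hw, ?_, h3, by simpa using h4⟩
    rw [← e.image_symm]
    exact h2.image _ e.symm.continuous.continuousOn
  rcases I.eq_empty_or_nonempty with rfl | hne
  · have hem : planeCurve ∅ X Y = ∅ := by
      ext; simp [planeCurve]
    refine red 0 0 (by simp [hem]) (by simp [hem]) fun z _ =>
      ⟨univ, by simp [hem], isPreconnected_univ, mem_univ _, Or.inl (mem_univ _)⟩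
  obtain ⟨t₀, ht₀⟩ := hne
  have hU : (X t₀, Y t₀ + 1) ∈ aboveCurve I X Y := ⟨t₀, ht₀, rfl, by simp⟩
  have hL : (X t₀, Y t₀ - 1) ∈ belowCurve I X Y := ⟨t₀, ht₀, rfl, by simp⟩
  refine red _ _ (aboveCurve_subset_compl hinj hU) (belowCurve_subset_compl hinj hL) fun z hz => ?_
  by_cases hzJ : z.1 ∈ X '' I
  · obtain ⟨t, ht, hx⟩ := hzJ
    rcases lt_trichotomy z.2 (Y t) with h | h | h
    · exact ⟨_, belowCurve_subset_compl hinj, isPreconnected_belowCurve hI hX hY,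
        ⟨t, ht, hx.symm, h⟩, Or.inr hL⟩
    · exact absurd ⟨t, ht, Prod.ext hx.symm h⟩ hz
    · exact ⟨_, aboveCurve_subset_compl hinj, isPreconnected_aboveCurve hI hX hY,
        ⟨t, ht, hx.symm, h⟩, Or.inl hU⟩
  · have hJ : (X '' I).OrdConnected := (hI.image X hX).ordConnected
    have hside : (∀ t ∈ I, X t < z.1) ∨ (∀ t ∈ I, z.1 < X t) := by
      by_contra! hcon
      obtain ⟨⟨s, hs, hsz⟩, t, ht, htz⟩ := hcon
      exact hzJ (hJ.out ⟨t, ht, rfl⟩ ⟨s, hs, rfl⟩ ⟨htz, hsz⟩)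
    obtain ⟨T, h1, h2, h3, h4⟩ := hside.elim
      (fun h => exists_preconnected_of_right hI ⟨t₀, ht₀⟩ hX hY hinj h)
      (fun h => exists_preconnected_of_left hI ⟨t₀, ht₀⟩ hX hY hinj h)
    exact ⟨T, h1, h2, h3, h4.imp (fun h => h hU) (fun h => h hL)⟩

end planeCurve

/-! ### Derivatives of exponential sums -/

theorem partialDeriv_expSum {n : ℕ} (S : SignedSupport n) (c : S.supp → ℝ) (j : Fin n) :
    partialDeriv j (S.expSum c) = S.expSum fun i => c i * (i : E n) j := by
  funext x
  have h : HasFDerivAt (S.expSum c)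
      (∑ i : S.supp, c i • (Real.exp (inner ℝ (i : E n) x) • innerSL ℝ (i : E n))) x := by
    unfold SignedSupport.expSum
    refine HasFDerivAt.fun_sum fun i _ => ?_
    exact (((innerSL ℝ (i : E n)).hasFDerivAt (x := x)).exp).const_mul (c i)
  simp only [partialDeriv, h.fderiv, sum_apply, smul_apply,
    innerSL_apply_apply, EuclideanSpace.inner_single_right, SignedSupport.expSum]
  refine Finset.sum_congr rfl fun i _ => ?_
  simp
  ring

theorem hess_expSum_apply {n : ℕ} (S : SignedSupport n) (c : S.supp → ℝ) (x : E n)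
    (j k : Fin n) :
    hess (S.expSum c) x j k =
      ∑ i : S.supp, c i * Real.exp (inner ℝ (i : E n) x) * ((i : E n) j * (i : E n) k) := by
  simp only [hess, Matrix.of_apply, partialDeriv_expSum, SignedSupport.expSum]
  exact Finset.sum_congr rfl fun i _ => by ring

theorem mem_Sing_expSum {n : ℕ} (S : SignedSupport n) (c : S.supp → ℝ) (x : E n) :
    x ∈ Sing (S.expSum c) ↔
      (∑ i : S.supp, c i * Real.exp (inner ℝ (i : E n) x) = 0) ∧
      ∀ j, ∑ i : S.supp, c i * Real.exp (inner ℝ (i : E n) x) * (i : E n) j = 0 := by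
  simp only [Sing, mem_ofPred_eq, partialDeriv_expSum, SignedSupport.expSum]
  refine and_congr Iff.rfl (forall_congr' fun j => ?_)
  rw [Finset.sum_congr rfl fun i _ => by rw [mul_right_comm]]

/-! ### Enclosing hyperplanes -/

theorem interior_halfSpaceGE {n : ℕ} {v : E n} (hv : v ≠ 0) (a : ℝ) :
    interior (halfSpaceGE v a) = {μ | a < inner ℝ v μ} := by
  have ho : IsOpenMap (innerSL ℝ v) := ContinuousLinearMap.isOpenMap_of_ne_zero _
    fun h => hv (by simpa using congrArg (fun f => f v) h)
  have h := ho.preimage_interior_eq_interior_preimage (innerSL ℝ v).continuous (Ici a)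
  rw [interior_Ici] at h
  exact h.symm

theorem interior_halfSpaceLE {n : ℕ} {v : E n} (hv : v ≠ 0) (a : ℝ) :
    interior (halfSpaceLE v a) = {μ | inner ℝ v μ < a} := by
  have ho : IsOpenMap (innerSL ℝ v) := ContinuousLinearMap.isOpenMap_of_ne_zero _
    fun h => hv (by simpa using congrArg (fun f => f v) h)
  have h := ho.preimage_interior_eq_interior_preimage (innerSL ℝ v).continuous (Iic a)
  rw [interior_Iic] at h
  exact h.symm

/-- For an affine relation `w` that is positive on `P` and negative on `Q`, the second moment of
`w` in the normal direction of strict enclosing hyperplanes of `P` is negative. -/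
theorem IsStrictEnclosing.sum_mul_inner_sq_neg {n : ℕ} {s : Finset (E n)} {w : s → ℝ}
    {P Q : Set (E n)} {v : E n} {a b : ℝ} (h : IsStrictEnclosing P Q v a b)
    (hw0 : ∑ i, w i = 0) (hw1 : ∀ j, ∑ i, w i * (i : E n) j = 0)
    (hPQ : ∀ i : s, ((i : E n) ∈ P ∧ 0 < w i) ∨ ((i : E n) ∈ Q ∧ w i < 0))
    (hQ : ∀ q ∈ Q, ∃ i : s, (i : E n) = q ∧ w i < 0) :
    ∑ i : s, w i * inner ℝ v (i : E n) ^ 2 < 0 := by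
  have hlin : ∑ i : s, w i * inner ℝ v (i : E n) = 0 := by
    simp only [PiLp.inner_apply, Finset.mul_sum]
    rw [Finset.sum_comm]
    refine Finset.sum_eq_zero fun j _ => ?_
    have := congrArg (v j * ·) (hw1 j)
    simp only [mul_zero, Finset.mul_sum] at this
    rw [← this]
    exact Finset.sum_congr rfl fun i _ => by simp; ring
  -- The two sums differ by multiples of the zeroth and first moments, which vanish. The new factor
  -- is nonpositive on the closed strip and nonnegative off the open one.
  have hsum : ∑ i : s, w i * inner ℝ v (i : E n) ^ 2 =
      ∑ i : s, w i * ((inner ℝ v (i : E n) - a) * (inner ℝ v (i : E n) - b)) := by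
    have : ∀ i : s, w i * ((inner ℝ v (i : E n) - a) * (inner ℝ v (i : E n) - b)) =
        w i * inner ℝ v (i : E n) ^ 2 - (a + b) * (w i * inner ℝ v (i : E n)) + a * b * w i :=
      fun i => by ring
    simp only [this, Finset.sum_add_distrib, Finset.sum_sub_distrib, ← Finset.mul_sum, hlin, hw0]
    ring
  rw [hsum]
  obtain ⟨q, hq, hqQ⟩ := h.beyond_upper
  rw [interior_halfSpaceGE h.normal_ne_zero] at hq
  obtain ⟨i₀, rfl, hi₀⟩ := hQ q hqQ
  refine Finset.sum_neg' (fun i _ => ?_) ⟨i₀, Finset.mem_univ _, ?_⟩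
  · rcases hPQ i with ⟨hi, hwi⟩ | ⟨hi, hwi⟩
    · have h1 : inner ℝ v (i : E n) ≤ a := (h.inside hi).1
      have h2 : b ≤ inner ℝ v (i : E n) := (h.inside hi).2
      exact mul_nonpos_of_nonneg_of_nonpos hwi.le
        (mul_nonpos_of_nonpos_of_nonneg (by linarith) (by linarith))
    · have h1 := h.outside hi
      rw [interior_halfSpaceGE h.normal_ne_zero, interior_halfSpaceLE h.normal_ne_zero] at h1
      refine mul_nonpos_of_nonpos_of_nonneg hwi.le ?_
      by_contra! hcon
      refine h1 ⟨?_, ?_⟩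
      · show inner ℝ v (i : E n) < a
        nlinarith [h.le]
      · show b < inner ℝ v (i : E n)
        nlinarith [h.le]
  · have h1 : a < inner ℝ v (i₀ : E n) := hq
    exact mul_neg_of_neg_of_pos hi₀ (mul_pos (by linarith) (by linarith [h.le]))

theorem sign_cases {n : ℕ} {S : SignedSupport n} {w : S.supp → ℝ} (hw : w ∈ S.orthant)
    (i : S.supp) : ((i : E n) ∈ S.pos ∧ 0 < w i) ∨ ((i : E n) ∈ S.neg ∧ w i < 0) := by
  have h := hw i
  rcases Int.units_eq_one_or (S.sgn i) with h1 | h1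
  · refine Or.inl ⟨⟨i.2, h1⟩, ?_⟩
    rw [h1] at h
    rcases lt_trichotomy (w i) 0 with h2 | h2 | h2
    · rw [Real.sign_of_neg h2] at h; norm_num at h
    · rw [h2, Real.sign_zero] at h; norm_num at h
    · exact h2
  · refine Or.inr ⟨⟨i.2, h1⟩, ?_⟩
    rw [h1] at h
    rcases lt_trichotomy (w i) 0 with h2 | h2 | h2
    · exact h2
    · rw [h2, Real.sign_zero] at h; norm_num at h
    · rw [Real.sign_of_pos h2] at h; norm_num at h

theorem mem_orthant_iff {n : ℕ} {S : SignedSupport n} {w : S.supp → ℝ} :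
    w ∈ S.orthant ↔ ∀ i, 0 < ((S.sgn i : ℤ) : ℝ) * w i := by
  refine ⟨fun hw i => ?_, fun hw i => ?_⟩
  · have h := hw i
    rcases sign_cases hw i with ⟨-, h1⟩ | ⟨-, h1⟩
    · rw [← h, Real.sign_of_pos h1]; linarith
    · rw [← h, Real.sign_of_neg h1]; linarith
  · have h := hw i
    rcases Int.units_eq_one_or (S.sgn i) with h1 | h1
    · rw [h1] at h ⊢
      rw [Real.sign_of_pos (by simpa using h)]; simp
    · rw [h1] at h ⊢
      rw [Real.sign_of_neg (by simpa using h)]; simp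

/-- The matrix of second moments of a weight `w`. -/
def secondMoment {n : ℕ} {s : Finset (E n)} (w : s → ℝ) : Matrix (Fin n) (Fin n) ℝ :=
  Matrix.of fun j k => ∑ i : s, w i * ((i : E n) j * (i : E n) k)

theorem sum_mul_inner_sq_eq {s : Finset (E 2)} (w : s → ℝ) (v : E 2) :
    ∑ i : s, w i * inner ℝ v (i : E 2) ^ 2 =
      secondMoment w 0 0 * v 0 ^ 2 + 2 * secondMoment w 0 1 * (v 0 * v 1) +
        secondMoment w 1 1 * v 1 ^ 2 := by
  simp only [secondMoment, Matrix.of_apply, PiLp.inner_apply, Fin.sum_univ_two, Finset.mul_sum,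
    Finset.sum_mul, ← Finset.sum_add_distrib]
  exact Finset.sum_congr rfl fun i _ => by simp; ring

theorem secondMoment_symm {n : ℕ} {s : Finset (E n)} (w : s → ℝ) (j k : Fin n) :
    secondMoment w j k = secondMoment w k j := by
  simp only [secondMoment, Matrix.of_apply]
  exact Finset.sum_congr rfl fun i _ => by ring

/-- Completing the square, `a` times the form is `(a x + b y)² + (a d - b²) y²`. If `a d - b² ≥ 0`,
values of both signs force `a = 0`, then `b = 0`, and `d y²` cannot change sign. -/
theorem det_neg_of_indefinite {a b d p q r s : ℝ}
    (h1 : a * p ^ 2 + 2 * b * (p * q) + d * q ^ 2 < 0)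
    (h2 : 0 < a * r ^ 2 + 2 * b * (r * s) + d * s ^ 2) : a * d - b * b < 0 := by
  by_contra! hdet
  have e1 : 0 ≤ a * (a * p ^ 2 + 2 * b * (p * q) + d * q ^ 2) := by
    nlinarith [sq_nonneg (a * p + b * q), mul_nonneg hdet (sq_nonneg q)]
  have e2 : 0 ≤ a * (a * r ^ 2 + 2 * b * (r * s) + d * s ^ 2) := by
    nlinarith [sq_nonneg (a * r + b * s), mul_nonneg hdet (sq_nonneg s)]
  have ha : a = 0 := le_antisymm (by by_contra! h; nlinarith) (by by_contra! h; nlinarith)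
  subst ha
  have hb : b = 0 := by nlinarith
  subst hb
  have hd : d < 0 := by by_contra! h; nlinarith [mul_nonneg h (sq_nonneg q)]
  nlinarith [mul_nonneg (neg_nonneg.2 hd.le) (sq_nonneg s)]

theorem det_secondMoment_neg {S : SignedSupport 2}
    (hpos : ∃ (v : E 2) (a b : ℝ), IsStrictEnclosing S.pos S.neg v a b)
    (hneg : ∃ (v : E 2) (a b : ℝ), IsStrictEnclosing S.neg S.pos v a b)
    {w : S.supp → ℝ} (hw : w ∈ S.orthant)
    (hw0 : ∑ i, w i = 0) (hw1 : ∀ j, ∑ i, w i * (i : E 2) j = 0) :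
    secondMoment w 0 0 * secondMoment w 1 1 - secondMoment w 0 1 * secondMoment w 0 1 < 0 := by
  obtain ⟨v, a, b, hv⟩ := hpos
  obtain ⟨u, a', b', hu⟩ := hneg
  have hnp : ∀ q ∈ S.neg, ∃ i : S.supp, (i : E 2) = q ∧ w i < 0 := by
    rintro q ⟨h, hs⟩
    have := mem_orthant_iff.1 hw ⟨q, h⟩
    rw [hs] at this
    exact ⟨⟨q, h⟩, rfl, by simpa using this⟩
  have hpp : ∀ q ∈ S.pos, ∃ i : S.supp, (i : E 2) = q ∧ -w i < 0 := by
    rintro q ⟨h, hs⟩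
    have := mem_orthant_iff.1 hw ⟨q, h⟩
    rw [hs] at this
    exact ⟨⟨q, h⟩, rfl, by simpa using this⟩
  have h1 := hv.sum_mul_inner_sq_neg hw0 hw1 (sign_cases hw) hnp
  have h2 := hu.sum_mul_inner_sq_neg (w := fun i => -w i) (by rw [Finset.sum_neg_distrib, hw0, neg_zero])
    (fun j => by
      simp only [neg_mul, Finset.sum_neg_distrib, hw1 j, neg_zero]) (fun i => by
      rcases sign_cases hw i with h | h
      · exact Or.inr ⟨h.1, by linarith [h.2]⟩
      · exact Or.inl ⟨h.1, by linarith [h.2]⟩) hpp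
  simp only [neg_mul, Finset.sum_neg_distrib, neg_lt_zero] at h2
  rw [sum_mul_inner_sq_eq] at h1 h2
  exact det_neg_of_indefinite h1 h2

theorem hasEigenvalue_of_charpoly_root {H : Matrix (Fin 2) (Fin 2) ℝ} {μ : ℝ}
    (h : (H 0 0 - μ) * (H 1 1 - μ) - H 0 1 * H 1 0 = 0) :
    Module.End.HasEigenvalue (Matrix.toLin' H) μ := by
  have hdet : (H - μ • (1 : Matrix (Fin 2) (Fin 2) ℝ)).det = 0 := by
    rw [Matrix.det_fin_two]
    simpa using h
  obtain ⟨v, hv, hv0⟩ := Matrix.exists_mulVec_eq_zero_iff.2 hdet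
  refine Module.End.hasEigenvalue_of_hasEigenvector (x := v)
    ⟨Module.End.mem_eigenspace_iff.2 ?_, hv⟩
  rw [Matrix.sub_mulVec, Matrix.smul_mulVec, Matrix.one_mulVec, sub_eq_zero] at hv0
  simpa using hv0

/-- Since `δ < 0`, the discriminant `τ² - 4δ` of the characteristic polynomial exceeds `τ²`, so the
roots `(τ ± r) / 2` are real with opposite signs. -/
theorem exists_eigenvalues_of_det_neg {H : Matrix (Fin 2) (Fin 2) ℝ}
    (h : H 0 0 * H 1 1 - H 0 1 * H 1 0 < 0) :
    (∃ μ : ℝ, 0 < μ ∧ Module.End.HasEigenvalue (Matrix.toLin' H) μ) ∧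
      ∃ ν : ℝ, ν < 0 ∧ Module.End.HasEigenvalue (Matrix.toLin' H) ν := by
  set τ := H 0 0 + H 1 1 with hτ
  set δ := H 0 0 * H 1 1 - H 0 1 * H 1 0 with hδ
  have hD : 0 ≤ τ ^ 2 - 4 * δ := by nlinarith [sq_nonneg τ]
  set r := Real.sqrt (τ ^ 2 - 4 * δ) with hr
  have hr2 : r ^ 2 = τ ^ 2 - 4 * δ := Real.sq_sqrt hD
  have habs : |τ| < r := by
    rw [← Real.sqrt_sq_eq_abs]
    exact Real.sqrt_lt_sqrt (sq_nonneg _) (by linarith)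
  obtain ⟨h1, h2⟩ := abs_lt.1 habs
  refine ⟨⟨(τ + r) / 2, by linarith, hasEigenvalue_of_charpoly_root ?_⟩,
    ⟨(τ - r) / 2, by linarith, hasEigenvalue_of_charpoly_root ?_⟩⟩
  · rw [hδ, hτ] at hr2; rw [hτ]; linear_combination hr2 / 4
  · rw [hδ, hτ] at hr2; rw [hτ]; linear_combination hr2 / 4

/-! ### The signed reduced discriminant as a parametrized curve -/

section Gale

variable {S : SignedSupport 2}

theorem hatA_mulVec_eq_zero_iff (w : S.supp → ℝ) :
    w ∈ LinearMap.ker S.hatA.mulVecLin ↔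
      ∑ i, w i = 0 ∧ ∀ j, ∑ i : S.supp, w i * (i : E 2) j = 0 := by
  rw [LinearMap.mem_ker, Matrix.mulVecLin_apply, funext_iff, Fin.forall_fin_succ]
  simp only [Matrix.mulVec, dotProduct, SignedSupport.hatA, Matrix.of_apply, Fin.cons_zero,
    Fin.cons_succ, Pi.zero_apply, mul_comm _ (w _), mul_one]

/-- A linear form vanishing on all affine relations of the support is an affine function of the
exponents. -/
theorem exists_affine_of_orthogonal_ker {u : S.supp → ℝ}
    (hu : ∀ z ∈ LinearMap.ker S.hatA.mulVecLin, ∑ i, u i * z i = 0) :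
    ∃ g₀ g₁ g₂ : ℝ, ∀ i : S.supp, u i = g₀ + g₁ * (i : E 2) 0 + g₂ * (i : E 2) 1 := by
  classical
  let K : (S.supp → ℝ) →ₗ[ℝ] ℝ := ∑ i, u i • LinearMap.proj i
  have hK : ∀ z, K z = ∑ i, u i * z i := fun z => by simp [K, LinearMap.sum_apply]
  -- The kernel is the common kernel of the three row functionals, so a functional vanishing on it
  -- is a combination of the rows; evaluating at unit vectors reads off `u`.
  let L : Fin 3 → (S.supp → ℝ) →ₗ[ℝ] ℝ := fun r => LinearMap.proj r ∘ₗ S.hatA.mulVecLin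
  have hle : ⨅ r, (L r).ker ≤ K.ker := by
    intro z hz
    rw [LinearMap.mem_ker, hK]
    refine hu z ?_
    rw [LinearMap.mem_ker]
    funext r
    exact LinearMap.mem_ker.1 ((Submodule.mem_iInf _).1 hz r)
  obtain ⟨g, hg⟩ := (Submodule.mem_span_range_iff_exists_fun ℝ).1 (mem_span_of_iInf_ker_le_ker hle)
  refine ⟨g 0, g 1, g 2, fun i => ?_⟩
  have h := congrArg (fun f => f (Pi.single i 1)) hg
  simp only [hK, Fin.sum_univ_three, LinearMap.add_apply, LinearMap.smul_apply, smul_eq_mul, L,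
    LinearMap.comp_apply, Matrix.mulVecLin_apply, Matrix.mulVec_single_one, LinearMap.proj_apply,
    Matrix.col_apply, SignedSupport.hatA, Matrix.of_apply] at h
  rw [Finset.sum_eq_single i (fun j _ hj => by simp [hj]) (fun h => absurd (Finset.mem_univ i) h)]
    at h
  simp only [Pi.single_eq_same, mul_one] at h
  rw [← h]
  have e1 : (Fin.cons 1 (fun j => (i : E 2) j) : Fin 3 → ℝ) 1 = (i : E 2) 0 := rfl
  have e2 : (Fin.cons 1 (fun j => (i : E 2) j) : Fin 3 → ℝ) 2 = (i : E 2) 1 := rfl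
  rw [e1, e2, Fin.cons_zero, mul_one]

/-- A nondegenerate second moment matrix makes the parametrization of the reduced discriminant
an immersion. -/
theorem sum_sq_div_ne_zero
    (hdet : ∀ w ∈ S.orthant, w ∈ LinearMap.ker S.hatA.mulVecLin →
      secondMoment w 0 0 * secondMoment w 1 1 - secondMoment w 0 1 * secondMoment w 0 1 ≠ 0)
    {C D : S.supp → ℝ} (hC : C ∈ LinearMap.ker S.hatA.mulVecLin)
    (hD : D ∈ LinearMap.ker S.hatA.mulVecLin)
    (hspan : ∀ w ∈ LinearMap.ker S.hatA.mulVecLin, ∃ p q : ℝ, w = p • C + q • D)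
    (hind : ∀ p q : ℝ, p • C + q • D = 0 → p = 0 ∧ q = 0)
    {t : ℝ} (ht : C + t • D ∈ S.orthant) :
    ∑ i, D i * (D i / (C i + t * D i)) ≠ 0 := by
  intro h0
  set w : S.supp → ℝ := C + t • D with hw
  have hwi : ∀ i, w i = C i + t * D i := fun i => by simp [hw]
  have hwker : w ∈ LinearMap.ker S.hatA.mulVecLin :=
    Submodule.add_mem _ hC (Submodule.smul_mem _ _ hD)
  have hwne : ∀ i, w i ≠ 0 := fun i h => by
    have := mem_orthant_iff.1 ht i
    rw [h, mul_zero] at this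
    exact lt_irrefl _ this
  simp only [← hwi] at h0
  obtain ⟨hw0, hw1⟩ := (hatA_mulVec_eq_zero_iff w).1 hwker
  obtain ⟨hD0, hD1⟩ := (hatA_mulVec_eq_zero_iff D).1 hD
  -- Because `C = w - t D` and `∑ D = 0`, orthogonality of `D / w` to `D` gives orthogonality to
  -- `C`, hence to all relations; so `D / w` is affine in the exponents.
  have hCu : ∑ i, C i * (D i / w i) = 0 := by
    have : ∀ i, C i * (D i / w i) = D i - t * (D i * (D i / w i)) := fun i => by
      have h1 : w i * (D i / w i) = D i := mul_div_cancel₀ _ (hwne i)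
      linear_combination h1 - (D i / w i) * hwi i
    simp only [this, Finset.sum_sub_distrib, ← Finset.mul_sum, h0, hD0]
    simp
  obtain ⟨g₀, g₁, g₂, hg⟩ := exists_affine_of_orthogonal_ker (u := fun i => D i / w i) (by
    intro z hz
    obtain ⟨p, q, rfl⟩ := hspan z hz
    have : ∀ i, D i / w i * (p • C + q • D) i =
        p * (C i * (D i / w i)) + q * (D i * (D i / w i)) := fun i => by
      simp only [Pi.add_apply, Pi.smul_apply, smul_eq_mul]; ring
    simp only [this, Finset.sum_add_distrib, ← Finset.mul_sum, h0, hCu]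
    simp)
  have hDg : ∀ i, D i = g₀ * w i + g₁ * (w i * (i : E 2) 0) + g₂ * (w i * (i : E 2) 1) := by
    intro i
    have h1 : w i * (D i / w i) = D i := mul_div_cancel₀ _ (hwne i)
    rw [← h1, hg i]
    ring
  -- Take first moments of `D = w · (affine function)`. The constant term drops out, which leaves
  -- the gradient `(g₁, g₂)` in the kernel of the second moment matrix.
  have hmom : ∀ j, g₁ * secondMoment w 0 j + g₂ * secondMoment w 1 j = 0 := by
    intro j
    have h1 := hD1 j
    have h2 : ∀ i : S.supp, D i * (i : E 2) j = g₀ * (w i * (i : E 2) j) +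
        g₁ * (w i * ((i : E 2) 0 * (i : E 2) j)) + g₂ * (w i * ((i : E 2) 1 * (i : E 2) j)) := by
      intro i
      rw [hDg i]; ring
    simp only [h2, Finset.sum_add_distrib, ← Finset.mul_sum, hw1 j] at h1
    simpa [secondMoment] using h1
  have hd := hdet w ht hwker
  have m0 := hmom 0
  have m1 := hmom 1
  rw [secondMoment_symm w 1 0] at m0
  have hg1 : g₁ = 0 := by
    refine (mul_eq_zero.1 (?_ : g₁ * (secondMoment w 0 0 * secondMoment w 1 1 -
      secondMoment w 0 1 * secondMoment w 0 1) = 0)).resolve_right hd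
    linear_combination secondMoment w 1 1 * m0 - secondMoment w 0 1 * m1
  have hg2 : g₂ = 0 := by
    refine (mul_eq_zero.1 (?_ : g₂ * (secondMoment w 0 0 * secondMoment w 1 1 -
      secondMoment w 0 1 * secondMoment w 0 1) = 0)).resolve_right hd
    linear_combination secondMoment w 0 0 * m1 - secondMoment w 0 1 * m0
  -- What remains is `D = g₀ (C + t D)`; independence gives `g₀ = 0` and then `-1 = 0`.
  obtain ⟨h1, h2⟩ := hind g₀ (g₀ * t - 1) (by
    funext i
    have := hDg i
    rw [hg1, hg2, hwi] at this
    simp only [Pi.add_apply, Pi.smul_apply, smul_eq_mul, Pi.zero_apply]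
    linarith)
  rw [h1] at h2
  norm_num at h2

/-- The parameters `t` for which `C + t D` has the prescribed signs. -/
def paramSet (S : SignedSupport 2) (C D : S.supp → ℝ) : Set ℝ := {t | C + t • D ∈ S.orthant}

theorem isPreconnected_paramSet (C D : S.supp → ℝ) : IsPreconnected (paramSet S C D) := by
  refine Convex.isPreconnected ?_
  intro s hs t ht p q hp hq hpq
  refine mem_orthant_iff.2 fun i => ?_
  have h1 := mem_orthant_iff.1 hs i
  have h2 := mem_orthant_iff.1 ht i
  simp only [Pi.add_apply, Pi.smul_apply, smul_eq_mul] at h1 h2 ⊢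
  have e : ((S.sgn i : ℤ) : ℝ) * (C i + (p * s + q * t) * D i) =
      p * (((S.sgn i : ℤ) : ℝ) * (C i + s * D i)) +
        q * (((S.sgn i : ℤ) : ℝ) * (C i + t * D i)) := by
    linear_combination (-(((S.sgn i : ℤ) : ℝ) * C i)) * hpq
  rw [e]
  rcases hp.eq_or_lt with rfl | hp
  · have : q = 1 := by linarith
    subst this; linarith
  · have := mul_pos hp h1
    have := mul_nonneg hq h2.le
    linarith

/-- The pairing of `F` with the logarithms of the weights `C + t D`. -/
noncomputable def logPairing (C D F : S.supp → ℝ) (t : ℝ) : ℝ := ∑ i, F i * Real.log |C i + t * D i|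

theorem hasDerivAt_logPairing {C D : S.supp → ℝ} (F : S.supp → ℝ) {t : ℝ}
    (ht : t ∈ paramSet S C D) :
    HasDerivAt (logPairing C D F) (∑ i, F i * (D i / (C i + t * D i))) t := by
  unfold logPairing
  simp only [Real.log_abs]
  refine HasDerivAt.fun_sum fun i _ => HasDerivAt.const_mul _ (HasDerivAt.log ?_ ?_)
  · simpa using ((hasDerivAt_id t).mul_const (D i)).const_add (C i)
  · intro h
    have := mem_orthant_iff.1 ht i
    simp only [Pi.add_apply, Pi.smul_apply, smul_eq_mul] at this
    rw [h, mul_zero] at this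
    exact lt_irrefl _ this

theorem continuousOn_logPairing (C D F : S.supp → ℝ) :
    ContinuousOn (logPairing C D F) (paramSet S C D) :=
  fun _ ht => (hasDerivAt_logPairing F ht).continuousAt.continuousWithinAt

/-- Rolle's theorem on the interval `paramSet S C D`: the sums assumed nonzero are the derivatives
of `logPairing C D D`. -/
theorem injOn_logPairing {C D : S.supp → ℝ}
    (h : ∀ t ∈ paramSet S C D, ∑ i, D i * (D i / (C i + t * D i)) ≠ 0) :
    InjOn (logPairing C D D) (paramSet S C D) := by
  have hord := (isPreconnected_paramSet C D).ordConnected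
  have key : ∀ s ∈ paramSet S C D, ∀ t ∈ paramSet S C D, s < t →
      logPairing C D D s ≠ logPairing C D D t := by
    intro s hs t ht hst he
    have hsub : Icc s t ⊆ paramSet S C D := hord.out hs ht
    obtain ⟨r, hr, h0⟩ := exists_hasDerivAt_eq_zero hst
      ((continuousOn_logPairing C D D).mono hsub) he
      (fun x hx => hasDerivAt_logPairing D (hsub (Ioo_subset_Icc_self hx)))
    exact h r (hsub (Ioo_subset_Icc_self hr)) h0
  intro s hs t ht he
  rcases lt_trichotomy s t with h1 | h1 | h1
  · exact absurd he (key s hs t ht h1)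
  · exact h1
  · exact absurd he.symm (key t ht s hs h1)

/-! ### Horn–Kapranov parametrization and the component count. -/

variable {B : Matrix S.supp (Fin 2) ℝ}

theorem SignedSupport.IsGaleDual.mulVec_mem_ker (hB : S.IsGaleDual B) (l : Fin 2 → ℝ) :
    B.mulVec l ∈ LinearMap.ker S.hatA.mulVecLin := by
  rw [← hB.2, ← Matrix.range_mulVecLin]
  exact ⟨l, rfl⟩

theorem SignedSupport.IsGaleDual.exists_mulVec_eq (hB : S.IsGaleDual B) {w : S.supp → ℝ}
    (hw : w ∈ LinearMap.ker S.hatA.mulVecLin) : ∃ l, B.mulVec l = w := by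
  rw [← hB.2, ← Matrix.range_mulVecLin] at hw
  exact hw

/-- The Horn–Kapranov parametrization of the signed reduced discriminant. -/
theorem mem_reducedDisc_iff (hB : S.IsGaleDual B) (g : Fin 2 → ℝ) :
    g ∈ S.reducedDisc B ↔ ∃ l : Fin 2 → ℝ, B.mulVec l ∈ S.orthant ∧
      g = B.transpose.mulVec fun i => Real.log |B.mulVec l i| := by
  constructor
  · rintro ⟨c, ⟨hc, x, hx⟩, rfl⟩
    rw [mem_Sing_expSum] at hx
    obtain ⟨l, hl⟩ := hB.exists_mulVec_eq
      (w := fun i => c i * Real.exp (inner ℝ (i : E 2) x)) ((hatA_mulVec_eq_zero_iff _).2 hx)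
    have hcne : ∀ i, c i ≠ 0 := fun i h => by
      have := mem_orthant_iff.1 hc i
      rw [h, mul_zero] at this
      exact lt_irrefl _ this
    refine ⟨l, ?_, ?_⟩
    · rw [hl, mem_orthant_iff]
      intro i
      rw [← mul_assoc]
      exact mul_pos (mem_orthant_iff.1 hc i) (Real.exp_pos _)
    · funext k
      have hker := (hatA_mulVec_eq_zero_iff _).1 (hB.mulVec_mem_ker (Pi.single k 1))
      simp only [Matrix.mulVec_single_one, Matrix.col_apply] at hker
      -- The logarithms change by a linear function of the exponents, which `Bᵀ` kills because the
      -- columns of `B` are affine relations.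
      have hlog : ∀ i, Real.log |B.mulVec l i| =
          Real.log |c i| + ((i : E 2) 0 * x 0 + (i : E 2) 1 * x 1) := by
        intro i
        rw [hl, abs_mul, Real.log_mul (abs_ne_zero.2 (hcne i)) (by positivity), Real.abs_exp,
          Real.log_exp]
        simp [PiLp.inner_apply, Fin.sum_univ_two, mul_comm]
      simp only [Matrix.mulVec, dotProduct, Matrix.transpose_apply] at hlog ⊢
      have h2 : ∀ i, B i k * (Real.log |c i| + ((i : E 2) 0 * x 0 + (i : E 2) 1 * x 1)) =
          B i k * Real.log |c i| + x 0 * (B i k * (i : E 2) 0) + x 1 * (B i k * (i : E 2) 1) :=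
        fun i => by ring
      simp only [hlog, h2, Finset.sum_add_distrib, ← Finset.mul_sum, hker.2]
      simp
  · rintro ⟨l, hl, rfl⟩
    -- When the coefficients are themselves an affine relation, the origin is a singular zero.
    refine ⟨B.mulVec l, ⟨hl, 0, ?_⟩, rfl⟩
    rw [mem_Sing_expSum]
    simpa using (hatA_mulVec_eq_zero_iff _).1 (hB.mulVec_mem_ker l)

/-- Coordinates of the plane with respect to a nonzero vector `(p, q)` and its rotation. -/
noncomputable def rotatedCoordinates (p q : ℝ) (h : p ^ 2 + q ^ 2 ≠ 0) : (Fin 2 → ℝ) ≃ₜ ℝ × ℝ where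
  toFun g := (p * g 1 - q * g 0, p * g 0 + q * g 1)
  invFun z := ![(p * z.2 - q * z.1) / (p ^ 2 + q ^ 2), (p * z.1 + q * z.2) / (p ^ 2 + q ^ 2)]
  left_inv g := by
    funext k
    fin_cases k
    · simp; field_simp; ring
    · simp; field_simp; ring
  right_inv z := by
    ext
    · simp; field_simp; ring
    · simp; field_simp; ring
  continuous_toFun := by fun_prop
  continuous_invFun := by
    refine continuous_pi fun k => ?_
    fin_cases k
    · simp; fun_prop
    · simp; fun_prop

theorem rotatedCoordinates_apply (p q : ℝ) (h : p ^ 2 + q ^ 2 ≠ 0) (g : Fin 2 → ℝ) :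
    rotatedCoordinates p q h g = (p * g 1 - q * g 0, p * g 0 + q * g 1) :=
  rfl

/-- If the second moment matrices of all affine relations with the prescribed signs are
nondegenerate, the complement of the signed reduced discriminant has at most two components. -/
theorem card_components_compl_reducedDisc_le_two (hB : S.IsGaleDual B) (hne : S.supp.Nonempty)
    (hdet : ∀ w ∈ S.orthant, w ∈ LinearMap.ker S.hatA.mulVecLin →
      secondMoment w 0 0 * secondMoment w 1 1 - secondMoment w 0 1 * secondMoment w 0 1 ≠ 0) :
    ENat.card (ConnectedComponents ↥((S.reducedDisc B)ᶜ)) ≤ 2 := by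
  obtain ⟨α, hα⟩ := hne
  set ε : ℝ := ((S.sgn ⟨α, hα⟩ : ℤ) : ℝ) with hε
  -- `(p, q)` is a row of `B` times its sign, so every admissible `l` has positive product with it.
  -- If it is nonzero, each admissible ray meets the line `(p, q) + t (-q, p)` exactly once; if it
  -- is zero, no `l` is admissible.
  set p : ℝ := ε * B ⟨α, hα⟩ 0 with hp
  set q : ℝ := ε * B ⟨α, hα⟩ 1 with hq
  have hmul : ∀ (l : Fin 2 → ℝ) (i : S.supp), B.mulVec l i = B i 0 * l 0 + B i 1 * l 1 :=
    fun l i => by simp [Matrix.mulVec, dotProduct, Fin.sum_univ_two]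
  have hposl : ∀ l : Fin 2 → ℝ, B.mulVec l ∈ S.orthant → 0 < p * l 0 + q * l 1 := by
    intro l hl
    have := mem_orthant_iff.1 hl ⟨α, hα⟩
    rw [hmul] at this
    rw [hp, hq]; linarith
  by_cases hN : p ^ 2 + q ^ 2 = 0
  · have hp0 : p = 0 := by nlinarith [sq_nonneg p, sq_nonneg q]
    have hq0 : q = 0 := by nlinarith [sq_nonneg p, sq_nonneg q]
    have hem : S.reducedDisc B = ∅ := by
      refine eq_empty_of_forall_notMem fun g hg => ?_
      obtain ⟨l, hl, -⟩ := (mem_reducedDisc_iff hB g).1 hg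
      have := hposl l hl
      rw [hp0, hq0] at this
      norm_num at this
    rw [hem]
    exact card_connectedComponents_le_two (p := 0) (q := 0) (by simp) (by simp) fun z _ =>
      ⟨univ, by simp, isPreconnected_univ, mem_univ _, Or.inl (mem_univ _)⟩
  set C := B.mulVec ![p, q] with hCdef
  set D := B.mulVec ![-q, p] with hDdef
  have hCi : ∀ i, C i = B i 0 * p + B i 1 * q := fun i => by rw [hCdef, hmul]; simp
  have hDi : ∀ i, D i = B i 0 * (-q) + B i 1 * p := fun i => by rw [hDdef, hmul]; simp
  have hC := hB.mulVec_mem_ker ![p, q]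
  have hD := hB.mulVec_mem_ker ![-q, p]
  rw [← hCdef] at hC
  rw [← hDdef] at hD
  have hspan : ∀ w ∈ LinearMap.ker S.hatA.mulVecLin, ∃ a b : ℝ, w = a • C + b • D := by
    intro w hw
    obtain ⟨l, rfl⟩ := hB.exists_mulVec_eq hw
    refine ⟨(p * l 0 + q * l 1) / (p ^ 2 + q ^ 2), (p * l 1 - q * l 0) / (p ^ 2 + q ^ 2), ?_⟩
    funext i
    simp only [Pi.add_apply, Pi.smul_apply, smul_eq_mul, hmul, hCi, hDi]
    field_simp
    ring
  have hind : ∀ a b : ℝ, a • C + b • D = 0 → a = 0 ∧ b = 0 := by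
    intro a b hab
    have hinj := Matrix.mulVec_injective_iff.2 hB.1
    have h0 : B.mulVec (a • ![p, q] + b • ![-q, p]) = B.mulVec 0 := by
      rw [Matrix.mulVec_add, Matrix.mulVec_smul, Matrix.mulVec_smul, Matrix.mulVec_zero]
      exact hab
    have h1 := hinj h0
    have e0 := congrFun h1 0
    have e1 := congrFun h1 1
    simp at e0 e1
    refine ⟨(mul_eq_zero.1 (?_ : a * (p ^ 2 + q ^ 2) = 0)).resolve_right hN,
      (mul_eq_zero.1 (?_ : b * (p ^ 2 + q ^ 2) = 0)).resolve_right hN⟩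
    · linear_combination p * e0 + q * e1
    · linear_combination p * e1 - q * e0
  have hcoord : ∀ u : S.supp → ℝ, rotatedCoordinates p q hN (B.transpose.mulVec u) =
      (∑ i, D i * u i, ∑ i, C i * u i) := by
    intro u
    rw [rotatedCoordinates_apply]
    simp only [Matrix.mulVec, dotProduct, Matrix.transpose_apply, Finset.mul_sum,
      ← Finset.sum_add_distrib, ← Finset.sum_sub_distrib, Prod.mk.injEq]
    exact ⟨Finset.sum_congr rfl fun i _ => by rw [hDi]; ring,
      Finset.sum_congr rfl fun i _ => by rw [hCi]; ring⟩
  have hset : S.reducedDisc B = rotatedCoordinates p q hN ⁻¹'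
      planeCurve (paramSet S C D) (logPairing C D D) (logPairing C D C) := by
    ext g
    rw [mem_reducedDisc_iff hB]
    constructor
    · rintro ⟨l, hl, rfl⟩
      have hs := hposl l hl
      -- These solve `l = s ((p, q) + t (-q, p))`, with `s > 0`.
      set s := (p * l 0 + q * l 1) / (p ^ 2 + q ^ 2) with hsdef
      set t := (p * l 1 - q * l 0) / (p * l 0 + q * l 1) with htdef
      have hspos : 0 < s := div_pos hs (lt_of_le_of_ne (by positivity) (Ne.symm hN))
      have hw : ∀ i, B.mulVec l i = s * (C i + t * D i) := by
        intro i
        have hst : s * t = (p * l 1 - q * l 0) / (p ^ 2 + q ^ 2) := by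
          rw [hsdef, htdef, mul_comm, div_mul_div_cancel₀ hs.ne']
        rw [mul_add, ← mul_assoc, hst, hmul, hCi, hDi, hsdef]
        field_simp
        ring
      have ht : t ∈ paramSet S C D := by
        refine mem_orthant_iff.2 fun i => ?_
        have h1 := mem_orthant_iff.1 hl i
        rw [hw] at h1
        simp only [Pi.add_apply, Pi.smul_apply, smul_eq_mul]
        exact pos_of_mul_pos_right (by linarith : 0 < s * (((S.sgn i : ℤ) : ℝ) *
          (C i + t * D i))) hspos.le
      refine ⟨t, ht, ?_⟩
      rw [hcoord]
      have hlog : ∀ i, Real.log |B.mulVec l i| = Real.log s + Real.log |C i + t * D i| := by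
        intro i
        have hne : C i + t * D i ≠ 0 := fun h => by
          have := mem_orthant_iff.1 hl i
          rw [hw, h, mul_zero, mul_zero] at this
          exact lt_irrefl _ this
        rw [hw, abs_mul, Real.log_mul (abs_ne_zero.2 hspos.ne') (abs_ne_zero.2 hne),
          abs_of_pos hspos]
      -- The entries of `C` and of `D` sum to zero, so the summand `log s` disappears from both
      -- coordinates.
      have hC0 := ((hatA_mulVec_eq_zero_iff C).1 hC).1
      have hD0 := ((hatA_mulVec_eq_zero_iff D).1 hD).1
      simp only [hlog, mul_add, Finset.sum_add_distrib, ← Finset.sum_mul, hC0, hD0, zero_mul,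
        zero_add, logPairing]
    · rintro ⟨t, ht, hgt⟩
      have hl : B.mulVec (![p, q] + t • ![-q, p]) = C + t • D := by
        rw [Matrix.mulVec_add, Matrix.mulVec_smul]
      refine ⟨![p, q] + t • ![-q, p], by rw [hl]; exact ht,
        (rotatedCoordinates p q hN).injective ?_⟩
      rw [hgt, hcoord, hl]
      rfl
  rw [hset]
  exact card_components_compl_planeCurve_le_two _ (isPreconnected_paramSet C D)
    (continuousOn_logPairing C D D) (continuousOn_logPairing C D C)
    (injOn_logPairing fun t ht => sum_sq_div_ne_zero hdet hC hD hspan hind ht)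

end Gale

end SignedDisc

theorem theorem4p8 (S : SignedDisc.SignedSupport 2) (hfull : S.FullDimensional)
    (hpos : ∃ (v : SignedDisc.E 2) (a b : ℝ), SignedDisc.IsStrictEnclosing S.pos S.neg v a b)
    (hneg : ∃ (v : SignedDisc.E 2) (a b : ℝ), SignedDisc.IsStrictEnclosing S.neg S.pos v a b) :
    (∀ c ∈ S.orthant, ∀ x ∈ SignedDisc.Sing (S.expSum c),
      (∃ μ : ℝ, 0 < μ ∧
        Module.End.HasEigenvalue (Matrix.toLin' (SignedDisc.hess (S.expSum c) x)) μ) ∧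
      (∃ ν : ℝ, ν < 0 ∧
        Module.End.HasEigenvalue (Matrix.toLin' (SignedDisc.hess (S.expSum c) x)) ν)) ∧
    (S.supp.card = 5 → ∀ B : Matrix S.supp (Fin 2) ℝ, S.IsGaleDual B →
      ENat.card (ConnectedComponents ↥((S.reducedDisc B)ᶜ)) ≤ 2) := by
  refine ⟨fun c hc x hx => ?_, fun hcard B hB => ?_⟩
  · obtain ⟨hw0, hw1⟩ := (SignedDisc.mem_Sing_expSum S c x).1 hx
    have hw : (fun i : S.supp => c i * Real.exp (inner ℝ (i : SignedDisc.E 2) x)) ∈ S.orthant :=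
      SignedDisc.mem_orthant_iff.2 fun i => by
        rw [← mul_assoc]
        exact mul_pos (SignedDisc.mem_orthant_iff.1 hc i) (Real.exp_pos _)
    have hH : SignedDisc.hess (S.expSum c) x = SignedDisc.secondMoment
        (fun i : S.supp => c i * Real.exp (inner ℝ (i : SignedDisc.E 2) x)) := by
      ext j k
      exact SignedDisc.hess_expSum_apply S c x j k
    rw [hH]
    refine SignedDisc.exists_eigenvalues_of_det_neg ?_
    rw [SignedDisc.secondMoment_symm _ 1 0]
    exact SignedDisc.det_secondMoment_neg hpos hneg hw hw0 hw1
  · refine SignedDisc.card_components_compl_reducedDisc_le_two hB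
      (Finset.card_pos.1 (by omega)) fun w hw hker => ?_
    obtain ⟨hw0, hw1⟩ := (SignedDisc.hatA_mulVec_eq_zero_iff w).1 hker
    exact (SignedDisc.det_secondMoment_neg hpos hneg hw hw0 hw1).ne
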